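/- Let $q$ be a prime power, let $n=2m-1$, and let $\mathrm{PG}(n,q)$ be the projective space whose elements are the subspaces $U$ of $V=\mathbb F_q^{\,n+1}$ with $0\ne U\ne V$. A flag is a set of pairwise incident subspaces; its type is the set of vector space dimensions of its members. Two maximal flags are opposite if there is a basis $b_1,\dots,b_{n+1}$ of $V$ such that one consists of the spaces $\langle b_1,\dots,b_k\rangle$ and the other of the spaces $\langle b_{n+1},\dots,b_{n+2-k}\rangle$, $1\le k\le n$. Two flags of types $J$ and $K$ are opposite if $K=\{n+1-j : j\in J\}$ and they can be extended to two opposite maximal flags. For a self-opposite type $J=\{n+1-j: j\in J\}$, an EKR-set of flags of type $J$ is a set of flags of type $J$, no two of which (equal or not) are opposite. Let $J\subseteq\{1,\dots,n\}$ be a self-opposite type with $m\in J$. Let $C$ be either (i) the set of all flags of type $J$ whose $m$-dimensional member contains a fixed point ($1$-dimensional subspace) $P$, or (ii) the set of all flags of type $J$ whose $m$-dimensional member is contained in a fixed hyperplane ($n$-dimensional subspace) $H$. Then $C$ is an EKR-set of flags of type $J$, and $$|C|=\frac{v}{1+q^{(n+1)/2}},$$ where $v$ is the total number of flags of type $J$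 in $\mathrm{PG}(n,q)$. -/

import Mathlib

/-- The coordinate space `K^(n+1)`, whose subspaces are the elements of `PG(n,K)`. -/
abbrev PGSpace (n : ℕ) (K : Type*) : Type _ := Fin (n + 1) → K

/-- A flag of `PG(n,K)`: a set of pairwise incident, nonzero proper subspaces of `K^(n+1)`. -/
@[ext]
structure PGFlag (n : ℕ) (K : Type*) [Field K] where
  spaces : Set (Submodule K (PGSpace n K))
  incident : ∀ U ∈ spaces, ∀ W ∈ spaces, U ≤ W ∨ W ≤ U
  ne_bot : ∀ U ∈ spaces, U ≠ ⊥
  ne_top : ∀ U ∈ spaces, U ≠ ⊤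

namespace PGFlag

variable {n : ℕ} {K : Type*} [Field K]

/-- The type of a flag: the set of vector space dimensions of its members. -/
noncomputable def type (F : PGFlag n K) : Set ℕ :=
  {k | ∃ U ∈ F.spaces, Module.finrank K U = k}

/-- The image `g F` of a flag under an element `g` of `GL(n+1,K)`. Scalars fix every subspace, so
this is the action of `PGL(n+1,K)` on flags. -/
def map (g : PGSpace n K ≃ₗ[K] PGSpace n K) (F : PGFlag n K) : PGFlag n K where
  spaces := {W | ∃ U ∈ F.spaces, W = U.map g.toLinearMap}
  incident := by
    rintro _ ⟨U, hU, rfl⟩ _ ⟨W, hW, rfl⟩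
    exact (F.incident U hU W hW).imp (fun h => Submodule.map_mono h)
      (fun h => Submodule.map_mono h)
  ne_bot := by
    rintro _ ⟨U, hU, rfl⟩ h
    exact F.ne_bot U hU ((Submodule.map_eq_bot_iff (p := U) (e := g)).mp h)
  ne_top := by
    rintro _ ⟨U, hU, rfl⟩ h
    refine F.ne_top U hU ?_
    rw [eq_top_iff]
    intro x _
    have hx : g x ∈ U.map g.toLinearMap := by rw [h]; trivial
    obtain ⟨y, hy, hxy⟩ := hx
    rwa [← g.injective hxy]

/-- The span `⟨e_1, …, e_k⟩` of the first `k` standard basis vectors. -/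
def standardSpace (n : ℕ) (K : Type*) [Field K] (k : ℕ) : Submodule K (PGSpace n K) :=
  Submodule.span K {v | ∃ j : Fin (n + 1), (j : ℕ) < k ∧ v = Pi.single j 1}

theorem standardSpace_mono {k l : ℕ} (h : k ≤ l) :
    standardSpace n K k ≤ standardSpace n K l := by
  apply Submodule.span_mono
  rintro v ⟨j, hj, rfl⟩
  exact ⟨j, lt_of_lt_of_le hj h, rfl⟩

/-- The standard maximal flag `⟨e_1⟩ ⊂ ⟨e_1, e_2⟩ ⊂ … ⊂ ⟨e_1, …, e_n⟩`, whose stabilizer is the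
subgroup `B` of the standard BN-pair. -/
def standard (n : ℕ) (K : Type*) [Field K] : PGFlag n K where
  spaces := {U | ∃ k, 1 ≤ k ∧ k ≤ n ∧ U = standardSpace n K k}
  incident := by
    rintro _ ⟨k, -, -, rfl⟩ _ ⟨l, -, -, rfl⟩
    exact (le_total k l).imp (fun h => standardSpace_mono h) (fun h => standardSpace_mono h)
  ne_bot := by
    rintro _ ⟨k, hk, -, rfl⟩ h
    have h0 : (Pi.single 0 1 : PGSpace n K) ∈ standardSpace n K k :=
      Submodule.subset_span ⟨0, lt_of_lt_of_le Nat.zero_lt_one hk, rfl⟩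
    rw [h, Submodule.mem_bot] at h0
    simpa using congrFun h0 0
  ne_top := by
    rintro _ ⟨k, -, hk, rfl⟩ h
    have hle : standardSpace n K k ≤
        LinearMap.ker (LinearMap.proj (R := K) (φ := fun _ : Fin (n + 1) => K) (Fin.last n)) := by
      refine Submodule.span_le.mpr ?_
      rintro v ⟨j, hj, rfl⟩
      have hne : Fin.last n ≠ j := by
        rintro rfl
        simp at hj
        omega
      simp [hne]
    have hl : (Pi.single (Fin.last n) 1 : PGSpace n K) ∈ standardSpace n K k := by
      rw [h]; trivial
    simpa using hle hl

/-- The linear map of a permutation `w` of the coordinates: `e_i ↦ e_{w i}`. -/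
def permLin (n : ℕ) (K : Type*) [Field K] (w : Equiv.Perm (Fin (n + 1))) :
    PGSpace n K ≃ₗ[K] PGSpace n K :=
  LinearEquiv.funCongrLeft K K w.symm

/-- The longest element of the Weyl group `Sym(n+1)`, the order-reversing permutation
`(1, n+1)(2, n)(3, n-1)⋯`. -/
def longest (n : ℕ) : Equiv.Perm (Fin (n + 1)) := Fin.revPerm

/-- The opposition relation on maximal flags: with `F₀ = B` the standard flag, the orbital
`{(h B, h w₀ B) | h ∈ G}` of the action of the linear group on maximal flags. -/
def MaxOpposite (F F' : PGFlag n K) : Prop :=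
  ∃ h : PGSpace n K ≃ₗ[K] PGSpace n K,
    F = (standard n K).map h ∧ F' = ((standard n K).map (permLin n K (longest n))).map h

/-- The action of `w₀` on types: conjugation by `w₀` maps the generator `s_k = (k, k+1)` to
`s_{n+1-k}`. -/
def oppositeType (n : ℕ) (J : Set ℕ) : Set ℕ :=
  {k | ∃ j ∈ J, k + j = n + 1}

/-- Two flags are opposite if `w₀` maps the type of one to the type of the other and they can be
extended to two opposite maximal flags. -/
def Opposite (F F' : PGFlag n K) : Prop :=
  oppositeType n F.type = F'.type ∧
    ∃ M M' : PGFlag n K, F.spaces ⊆ M.spaces ∧ F'.spaces ⊆ M'.spaces ∧ MaxOpposite M M'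

/-- The set of all flags of type `J`. -/
def ofType (n : ℕ) (K : Type*) [Field K] (J : Set ℕ) : Set (PGFlag n K) :=
  {F | F.type = J}

/-- An EKR-set of flags of (self-opposite) type `J`: a set of flags of type `J`, no two of which
are opposite. -/
def IsEKRSet (J : Set ℕ) (C : Set (PGFlag n K)) : Prop :=
  oppositeType n J = J ∧ C ⊆ ofType n K J ∧ ∀ F ∈ C, ∀ F' ∈ C, ¬ Opposite F F'

/-- The upper bound `v / (1 + q^((n+1)/2))`, with `v` the number of flags of type `J` and `q` the
order of the field. -/
noncomputable def ekrBound (n : ℕ) (K : Type*) [Field K] (J : Set ℕ) : ℝ :=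
  ((ofType n K J).ncard : ℝ) / (1 + (Nat.card K : ℝ) ^ (((n : ℝ) + 1) / 2))

/-- All flags of type `J` whose `m`-dimensional space contains the subspace `P`. -/
def through (J : Set ℕ) (m : ℕ) (P : Submodule K (PGSpace n K)) : Set (PGFlag n K) :=
  {F | F.type = J ∧ ∃ U ∈ F.spaces, Module.finrank K U = m ∧ P ≤ U}

/-- All flags of type `J` whose `m`-dimensional space is contained in the subspace `H`. -/
def inside (J : Set ℕ) (m : ℕ) (H : Submodule K (PGSpace n K)) : Set (PGFlag n K) :=
  {F | F.type = J ∧ ∃ U ∈ F.spaces, Module.finrank K U = m ∧ U ≤ H}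

end PGFlag

/-!
The middle-dimensional members of two opposite flags are complementary subspaces, so they cannot
share a point or lie in a common hyperplane. For the cardinality, double count the pairs `(w, F)`
of a nonzero vector `w` and a flag `F` whose `k`-dimensional member contains `w`: the general linear
group is transitive on points, so every `w` lies in the same number `c` of such members, and
`c (q ^ (n + 1) - 1) = v (q ^ k - 1)`. The hyperplane case is the same count in the dual space, with
annihilators in place of the members. For `n + 1 = 2 k` the factor `q ^ k - 1` cancels.
-/

open Module

section LinearAlgebra

variable {K V : Type*} [DivisionRing K] [AddCommGroup V] [Module K V]

theorem exists_linearEquiv_map_eq_of_finrank_eq {P Q : Submodule K V} [Module.Finite K P]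
    [Module.Finite K Q] (h : finrank K P = finrank K Q) :
    ∃ g : V ≃ₗ[K] V, P.map g.toLinearMap = Q := by
  let f : P ≃ₗ[K] Q := LinearEquiv.ofFinrankEq P Q h
  obtain ⟨g, hg⟩ := Submodule.exists_linearEquiv_restrict_eq f
  refine ⟨g, ?_⟩
  calc P.map g.toLinearMap
      = LinearMap.range (g.toLinearMap ∘ₗ P.subtype) := by
        rw [LinearMap.range_comp, Submodule.range_subtype]
    _ = LinearMap.range (Q.subtype ∘ₗ f.toLinearMap) :=
        congrArg LinearMap.range (LinearMap.ext fun x => (hg x).symm)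
    _ = Q := by rw [LinearMap.range_comp, f.range, Submodule.map_top, Submodule.range_subtype]

variable [Finite K] [Module.Finite K V]

theorem ncard_sdiff_singleton_zero (U : Submodule K V) :
    ((U : Set V) \ {0}).ncard = Nat.card K ^ finrank K U - 1 := by
  rw [Set.ncard_sdiff_singleton_of_mem U.zero_mem, ← Module.natCard_eq_pow_finrank,
    ← Nat.card_coe_set_eq]
  rfl

theorem mul_pow_finrank_sub_one_eq_of_forall_ncard_mem {α : Type*} {s : Set α} (hs : s.Finite)
    {S : α → Submodule K V} {k c : ℕ} (hS : ∀ a ∈ s, finrank K (S a) = k)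
    (hc : ∀ w : V, w ≠ 0 → {a ∈ s | w ∈ S a}.ncard = c) :
    c * (Nat.card K ^ finrank K V - 1) = s.ncard * (Nat.card K ^ k - 1) := by
  classical
  have : Finite V := Module.finite_of_finite K
  have := Fintype.ofFinite V
  lift s to Finset α using hs
  have hnonzero : (Finset.univ.erase (0 : V)).card = Nat.card K ^ finrank K V - 1 := by
    rw [Finset.card_erase_of_mem (Finset.mem_univ 0), Finset.card_univ, ← Nat.card_eq_fintype_card,
      Module.natCard_eq_pow_finrank (K := K)]
  rw [mul_comm, ← hnonzero, Set.ncard_coe_finset]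
  refine Finset.card_mul_eq_card_mul (fun w a => w ∈ S a) (fun w hw => ?_) fun a ha => ?_
  · rw [← hc w (Finset.ne_of_mem_erase hw), ← Set.ncard_coe_finset, Finset.coe_bipartiteAbove]
    rfl
  · rw [← hS a ha, ← ncard_sdiff_singleton_zero, ← Set.ncard_coe_finset, Finset.coe_bipartiteBelow]
    congr 1
    ext w
    simp [and_comm]

end LinearAlgebra

namespace PGFlag

variable {n : ℕ} {K : Type*} [Field K]

instance [Finite K] : Finite (PGFlag n K) :=
  Finite.of_injective spaces fun _ _ => PGFlag.ext

section Member

variable {F : PGFlag n K} {J : Set ℕ} {k : ℕ}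

theorem eq_of_finrank_eq {U W : Submodule K (PGSpace n K)} (hU : U ∈ F.spaces)
    (hW : W ∈ F.spaces) (h : finrank K U = finrank K W) : U = W :=
  (F.incident U hU W hW).elim (fun hle => Submodule.eq_of_le_of_finrank_eq hle h)
    (fun hle => (Submodule.eq_of_le_of_finrank_eq hle h.symm).symm)

/-- The `k`-dimensional member of a flag, so that it can be used as a function of the flag. It is
encoded as a supremum over a set with at most one element, hence is `⊥` if `k` is not in the type
of the flag. -/
noncomputable def member (F : PGFlag n K) (k : ℕ) : Submodule K (PGSpace n K) :=
  sSup {U | U ∈ F.spaces ∧ finrank K U = k}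

theorem member_finrank {U : Submodule K (PGSpace n K)} (hU : U ∈ F.spaces) :
    F.member (finrank K U) = U := by
  have hsingle : {W | W ∈ F.spaces ∧ finrank K W = finrank K U} = {U} :=
    Set.eq_singleton_iff_unique_mem.mpr ⟨⟨hU, rfl⟩, fun _ hW => eq_of_finrank_eq hW.1 hU hW.2⟩
  rw [member, hsingle, sSup_singleton]

theorem finrank_member (hk : k ∈ F.type) : finrank K (F.member k) = k := by
  obtain ⟨U, hU, rfl⟩ := hk
  rw [member_finrank hU]

theorem exists_mem_spaces_iff_member (hk : k ∈ F.type) {p : Submodule K (PGSpace n K) → Prop} :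
    (∃ U ∈ F.spaces, finrank K U = k ∧ p U) ↔ p (F.member k) := by
  constructor
  · rintro ⟨U, hU, rfl, h⟩
    rwa [member_finrank hU]
  · intro h
    obtain ⟨U, hU, rfl⟩ := hk
    exact ⟨U, hU, rfl, by rwa [member_finrank hU] at h⟩

theorem through_eq_setOf_le_member (hk : k ∈ J) (P : Submodule K (PGSpace n K)) :
    through J k P = {F ∈ ofType n K J | P ≤ F.member k} :=
  Set.ext fun _ => and_congr_right fun hF => exists_mem_spaces_iff_member (hF ▸ hk)

theorem inside_eq_setOf_member_le (hk : k ∈ J) (H : Submodule K (PGSpace n K)) :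
    inside J k H = {F ∈ ofType n K J | F.member k ≤ H} :=
  Set.ext fun _ => and_congr_right fun hF => exists_mem_spaces_iff_member (hF ▸ hk)

end Member

section LinearGroupAction

variable (g : PGSpace n K ≃ₗ[K] PGSpace n K) {J : Set ℕ} {k : ℕ}
  {P Q : Submodule K (PGSpace n K)}

theorem type_map (F : PGFlag n K) : (F.map g).type = F.type := by
  ext k
  constructor
  · rintro ⟨_, ⟨U, hU, rfl⟩, rfl⟩
    exact ⟨U, hU, (LinearEquiv.finrank_map_eq g U).symm⟩
  · rintro ⟨U, hU, rfl⟩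
    exact ⟨_, ⟨U, hU, rfl⟩, LinearEquiv.finrank_map_eq g U⟩

theorem map_injective : Function.Injective (map g : PGFlag n K → PGFlag n K) := by
  have hmap (F : PGFlag n K) : (F.map g).spaces = Submodule.map g.toLinearMap '' F.spaces := by
    ext W
    exact exists_congr fun U => and_congr_right fun _ => eq_comm
  intro F F' h
  have hinj := Submodule.map_injective_of_injective (f := g.toLinearMap) g.injective
  exact PGFlag.ext (hinj.image_injective (by rw [← hmap, ← hmap, h]))

theorem map_mem_through {F : PGFlag n K} (hF : F ∈ through J k P) :
    F.map g ∈ through J k (P.map g.toLinearMap) := by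
  obtain ⟨hJ, U, hU, hk, hPU⟩ := hF
  exact ⟨(type_map g F).trans hJ, _, ⟨U, hU, rfl⟩, (LinearEquiv.finrank_map_eq g U).trans hk,
    Submodule.map_mono hPU⟩

theorem map_mem_inside {F : PGFlag n K} (hF : F ∈ inside J k P) :
    F.map g ∈ inside J k (P.map g.toLinearMap) := by
  obtain ⟨hJ, U, hU, hk, hUP⟩ := hF
  exact ⟨(type_map g F).trans hJ, _, ⟨U, hU, rfl⟩, (LinearEquiv.finrank_map_eq g U).trans hk,
    Submodule.map_mono hUP⟩

theorem ncard_eq_of_map_mem [Finite K] {C : Submodule K (PGSpace n K) → Set (PGFlag n K)}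
    (hC : ∀ g P, ∀ F ∈ C P, F.map g ∈ C (P.map g.toLinearMap))
    (h : finrank K P = finrank K Q) : (C P).ncard = (C Q).ncard := by
  have hle {P Q : Submodule K (PGSpace n K)} (h : finrank K P = finrank K Q) :
      (C P).ncard ≤ (C Q).ncard := by
    obtain ⟨g, rfl⟩ := exists_linearEquiv_map_eq_of_finrank_eq h
    exact Set.ncard_le_ncard_of_injOn (map g) (hC g P) (map_injective g).injOn
  exact (hle h).antisymm (hle h.symm)

end LinearGroupAction

section Counting

variable [Finite K] {J : Set ℕ} {k : ℕ}

theorem ncard_through_mul_pow_sub_one (hk : k ∈ J) {P : Submodule K (PGSpace n K)}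
    (hP : finrank K P = 1) :
    (through J k P).ncard * (Nat.card K ^ (n + 1) - 1) =
      (ofType n K J).ncard * (Nat.card K ^ k - 1) := by
  have hcount (w : PGSpace n K) (hw : w ≠ 0) :
      {F ∈ ofType n K J | w ∈ F.member k}.ncard = (through J k P).ncard := by
    have hdim : finrank K (K ∙ w) = finrank K P := by rw [finrank_span_singleton hw, hP]
    rw [← ncard_eq_of_map_mem (fun g _ _ => map_mem_through g) hdim,
      through_eq_setOf_le_member hk]
    simp only [Submodule.span_singleton_le_iff_mem]
  have hmember : ∀ F ∈ ofType n K J, finrank K (F.member k) = k :=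
    fun F hF => finrank_member (hF.symm ▸ hk)
  simpa only [finrank_fin_fun] using
    mul_pow_finrank_sub_one_eq_of_forall_ncard_mem (Set.toFinite _) hmember hcount

theorem ncard_inside_mul_pow_sub_one (hk : k ∈ J) {H : Submodule K (PGSpace n K)}
    (hH : finrank K H = n) :
    (inside J k H).ncard * (Nat.card K ^ (n + 1) - 1) =
      (ofType n K J).ncard * (Nat.card K ^ (n + 1 - k) - 1) := by
  have hcount (f : Dual K (PGSpace n K)) (hf : f ≠ 0) :
      {F ∈ ofType n K J | f ∈ (F.member k).dualAnnihilator}.ncard = (inside J k H).ncard := by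
    have hdim : finrank K (LinearMap.ker f) = finrank K H := by
      have hker := Dual.finrank_ker_add_one_of_ne_zero hf
      rw [finrank_fin_fun] at hker
      omega
    rw [← ncard_eq_of_map_mem (fun g _ _ => map_mem_inside g) hdim,
      inside_eq_setOf_member_le hk]
    simp only [Submodule.mem_dualAnnihilator, SetLike.le_def, LinearMap.mem_ker]
  have hannihilator : ∀ F ∈ ofType n K J,
      finrank K (F.member k).dualAnnihilator = n + 1 - k := by
    intro F hF
    have hmember : finrank K (F.member k) = k := finrank_member (hF.symm ▸ hk)
    have hadd := Subspace.finrank_add_finrank_dualAnnihilator_eq (F.member k)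
    rw [hmember, finrank_fin_fun] at hadd
    omega
  simpa only [Subspace.dual_finrank_eq, finrank_fin_fun] using
    mul_pow_finrank_sub_one_eq_of_forall_ncard_mem (Set.toFinite _) hannihilator hcount

theorem eq_ekrBound_of_mul_pow_sub_one_eq {m c : ℕ} (hn : n + 1 = 2 * m)
    (h : c * (Nat.card K ^ (n + 1) - 1) = (ofType n K J).ncard * (Nat.card K ^ m - 1)) :
    (c : ℝ) = ekrBound n K J := by
  have hexp : ((n : ℝ) + 1) / 2 = m := by
    have hcast : (n : ℝ) + 1 = 2 * m := mod_cast hn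
    rw [hcast, mul_div_cancel_left₀ _ two_ne_zero]
  have hq : 1 < Nat.card K ^ m := Nat.one_lt_pow (by omega) Finite.one_lt_card
  have hfactor : Nat.card K ^ (n + 1) - 1 = (1 + Nat.card K ^ m) * (Nat.card K ^ m - 1) := by
    rw [hn, mul_comm 2 m, pow_mul, add_comm, ← Nat.sq_sub_sq, one_pow]
  rw [hfactor, ← mul_assoc] at h
  have hcancel : c * (1 + Nat.card K ^ m) = (ofType n K J).ncard :=
    Nat.eq_of_mul_eq_mul_right (Nat.sub_pos_of_lt hq) h
  rw [ekrBound, hexp, Real.rpow_natCast, eq_div_iff (by positivity)]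
  exact_mod_cast hcancel

end Counting

section Opposition

theorem standardSpace_eq_spanSubset (k : ℕ) :
    standardSpace n K k = Pi.spanSubset K {i : Fin (n + 1) | (i : ℕ) < k} := by
  rw [standardSpace, Pi.spanSubset]
  congr 1
  ext v
  simp [eq_comm]

theorem finrank_standardSpace {k : ℕ} (hk : k ≤ n + 1) : finrank K (standardSpace n K k) = k := by
  rw [standardSpace_eq_spanSubset, Pi.dim_spanSubset, Set.ncard_eq_toFinset_card']
  simp [Fin.card_filter_val_lt, hk]

theorem disjoint_standardSpace_map_longest {k l : ℕ} (hkl : k + l ≤ n + 1) :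
    Disjoint (standardSpace n K k)
      ((standardSpace n K l).map (permLin n K (longest n)).toLinearMap) := by
  simp only [standardSpace_eq_spanSubset]
  rw [Submodule.disjoint_def]
  rintro _ hx ⟨y, hy, rfl⟩
  ext i
  by_cases hi : (i : ℕ) < k
  · exact Pi.mem_spanSubset_iff.mp hy i.rev (by simp only [Set.mem_ofPred_eq, Fin.val_rev]; omega)
  · exact Pi.mem_spanSubset_iff.mp hx i hi

theorem Opposite.isCompl {F F' : PGFlag n K} (h : Opposite F F')
    {U U' : Submodule K (PGSpace n K)} (hU : U ∈ F.spaces) (hU' : U' ∈ F'.spaces)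
    (hd : finrank K U + finrank K U' = n + 1) : IsCompl U U' := by
  obtain ⟨-, M, M', hFM, hFM', g, rfl, rfl⟩ := h
  obtain ⟨_, ⟨k, -, hk, rfl⟩, rfl⟩ := hFM hU
  obtain ⟨_, ⟨_, ⟨l, -, hl, rfl⟩, rfl⟩, rfl⟩ := hFM' hU'
  refine (Submodule.isCompl_iff_disjoint _ _ (by rw [hd, finrank_fin_fun])).mpr ?_
  simp only [LinearEquiv.finrank_map_eq, finrank_standardSpace (hk.trans n.le_succ),
    finrank_standardSpace (hl.trans n.le_succ)] at hd
  exact Submodule.disjoint_map g.injective (disjoint_standardSpace_map_longest hd.le)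

variable {J : Set ℕ} {m : ℕ}

theorem isEKRSet_through (hn : n + 1 = 2 * m) (hJ : oppositeType n J = J)
    {P : Submodule K (PGSpace n K)} (hP : P ≠ ⊥) : IsEKRSet J (through J m P) := by
  refine ⟨hJ, fun F hF => hF.1, ?_⟩
  rintro F ⟨-, U, hU, hd, hPU⟩ F' ⟨-, U', hU', hd', hPU'⟩ hop
  have hcompl : IsCompl U U' := hop.isCompl hU hU' (by omega)
  exact hP (le_bot_iff.mp (hcompl.disjoint hPU hPU'))

theorem isEKRSet_inside (hn : n + 1 = 2 * m) (hJ : oppositeType n J = J)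
    {H : Submodule K (PGSpace n K)} (hH : H ≠ ⊤) : IsEKRSet J (inside J m H) := by
  refine ⟨hJ, fun F hF => hF.1, ?_⟩
  rintro F ⟨-, U, hU, hd, hUH⟩ F' ⟨-, U', hU', hd', hUH'⟩ hop
  have hcompl : IsCompl U U' := hop.isCompl hU hU' (by omega)
  exact hH (top_le_iff.mp (hcompl.codisjoint hUH hUH'))

end Opposition

end PGFlag

theorem mainTheorem8 {K : Type*} [Field K] [Finite K] (n m : ℕ) (hn : (n : ℤ) = 2 * m - 1)
    (J : Set ℕ) (hJ : J ⊆ Set.Icc 1 n) (hJop : PGFlag.oppositeType n J = J) (hm : m ∈ J)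
    (C : Set (PGFlag n K))
    (hC : (∃ P : Submodule K (PGSpace n K),
              Module.finrank K P = 1 ∧ C = PGFlag.through J m P) ∨
          (∃ H : Submodule K (PGSpace n K),
              Module.finrank K H = n ∧ C = PGFlag.inside J m H)) :
    PGFlag.IsEKRSet J C ∧ (C.ncard : ℝ) = PGFlag.ekrBound n K J := by
  have hn' : n + 1 = 2 * m := by omega
  rcases hC with ⟨P, hP, rfl⟩ | ⟨H, hH, rfl⟩
  · have hbot : P ≠ ⊥ := by
      rintro rfl
      simp at hP
    exact ⟨PGFlag.isEKRSet_through hn' hJop hbot, PGFlag.eq_ekrBound_of_mul_pow_sub_one_eq hn'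
      (PGFlag.ncard_through_mul_pow_sub_one hm hP)⟩
  · have htop : H ≠ ⊤ := by
      rintro rfl
      simp at hH
    have hdual : n + 1 - m = m := by omega
    have hcount := PGFlag.ncard_inside_mul_pow_sub_one hm hH
    rw [hdual] at hcount
    exact ⟨PGFlag.isEKRSet_inside hn' hJop htop,
      PGFlag.eq_ekrBound_of_mul_pow_sub_one_eq hn' hcount⟩
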